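/- An \emph{S5-algebra} is a Boolean algebra $A$ (possibly with one element) with an operation $\Diamond\colon A\to A$ such that $\Diamond 0=0$, $\Diamond(a\vee b)=\Diamond a\vee\Diamond b$, $a\le\Diamond a$, $\Diamond\Diamond a\le\Diamond a$ and $a\le\neg\Diamond\neg\Diamond a$; homomorphisms are the Boolean homomorphisms that preserve $\Diamond$. For $n>0$ let $\underline n=\{1,\dots,n\}$. Let $\mathcal L$ be the multi-sorted first-order language whose sorts are the positive integers and which has, for every surjection $f\colon\underline m\to\underline n$, a unary function symbol $f$ taking arguments of sort $n$ to values of sort $m$ (domains of sorts may be empty). For a term $x$ of sort $n$, let $\mathrm{Fix}(x)=1$ denote the formula $\bigwedge\{\neg(\sigma(x)=x)\mid \sigma\in S_n\setminus\{1\}\}$. Let $T_1$ be the $\mathcal L$-theory with the following axioms (free variables being universally quantified, and all functions $f,g$ being surjections between sets $\underline n$ with $n>0$): \begin{enumerate} \item $1(x)=x$ for $x$ of sort $n$, where $1$ is the identity of $\underline n$, and $f(g(x))=(g\circ f)(x)$ for all $f\colon\underline r\to\underline m$, $g\colon\underline m\to\underline n$ and $x$ of sort $n$; \item for every $n>0$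 and $x$ of sort $n$: $\bigvee\{\exists y\,(f(y)=x\wedge \mathrm{Fix}(y)=1)\mid m>0,\ f\colon\underline n\to\underline m\}$; \item for all $f\colon\underline k\to\underline n$, $g\colon\underline k\to\underline m$, with $x$ of sort $n$ and $y$ of sort $m$: $(f(x)=g(y)\wedge\mathrm{Fix}(x)=1\wedge\mathrm{Fix}(y)=1)\to\bigvee\{\sigma(y)=x\mid \sigma\colon\underline n\to\underline m \text{ bijective},\ \sigma\circ f=g\}$. \end{enumerate} \textbf{Corollary.} The category $\mathbf{S5}_{\mathrm{fin}}$ of finite S5-algebras and homomorphisms has finite limits and, as a lex category, classifies the models of $T_1$ and their homomorphisms as $\mathcal L$-structures. That is: for a functor $F\colon\mathbf{S5}_{\mathrm{fin}}\to\mathbf{Set}$ let $M_F$ be the $\mathcal L$-structure whose domain of sort $n$ is $F(\mathcal P(\underline n))$, where $\Diamond$ on the power set $\mathcal P(\underline n)$ sends $\emptyset$ to $\emptyset$ and every nonempty subset to $\underline n$, and in which the symbol of a surjection $f\colon\underline m\to\underline n$ is interpreted by $F(f^{-1})\colon F(\mathcal P(\underline n))\to F(\mathcal P(\underline m))$. If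 $F$ preserves finite limits, then $M_F$ is a model of $T_1$, and $F\mapsto M_F$ is an equivalence from the category of finite-limit-preserving functors $\mathbf{S5}_{\mathrm{fin}}\to\mathbf{Set}$ and natural transformations to the category of models of $T_1$ and homomorphisms of $\mathcal L$-structures. -/

import Mathlib

open CategoryTheory CategoryTheory.Limits

universe u

/- ### Finite S5-algebras -/

/-- An S5-algebra: a Boolean algebra with an operator `dia` (possibility) that is normal, additive,
and satisfies the axioms T, 4 and B of the modal logic S5. The one-element algebra is allowed. -/
class S5Algebra (A : Type u) extends BooleanAlgebra A where
  dia : A → A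
  dia_bot : dia ⊥ = ⊥
  dia_sup : ∀ a b : A, dia (a ⊔ b) = dia a ⊔ dia b
  le_dia : ∀ a : A, a ≤ dia a
  dia_dia_le : ∀ a : A, dia (dia a) ≤ dia a
  le_compl_dia_compl_dia : ∀ a : A, a ≤ (dia (dia a)ᶜ)ᶜ

/-- Homomorphisms of S5-algebras: homomorphisms of Boolean algebras (a map preserving `⊥`, `⊤`,
`⊔`, `⊓` preserves complements too) that preserve `dia`. -/
@[ext]
structure S5Hom (A B : Type u) [S5Algebra A] [S5Algebra B] where
  toFun : A → B
  map_bot : toFun ⊥ = ⊥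
  map_top : toFun ⊤ = ⊤
  map_sup : ∀ a b, toFun (a ⊔ b) = toFun a ⊔ toFun b
  map_inf : ∀ a b, toFun (a ⊓ b) = toFun a ⊓ toFun b
  map_dia : ∀ a, toFun (S5Algebra.dia a) = S5Algebra.dia (toFun a)

/-- The identity homomorphism. -/
def S5Hom.id (A : Type u) [S5Algebra A] : S5Hom A A where
  toFun a := a
  map_bot := rfl
  map_top := rfl
  map_sup _ _ := rfl
  map_inf _ _ := rfl
  map_dia _ := rfl

/-- Composition of homomorphisms, in diagrammatic order. -/
def S5Hom.comp {A B C : Type u} [S5Algebra A] [S5Algebra B] [S5Algebra C]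
    (h : S5Hom A B) (k : S5Hom B C) : S5Hom A C where
  toFun a := k.toFun (h.toFun a)
  map_bot := by rw [h.map_bot, k.map_bot]
  map_top := by rw [h.map_top, k.map_top]
  map_sup a b := by rw [h.map_sup, k.map_sup]
  map_inf a b := by rw [h.map_inf, k.map_inf]
  map_dia a := by rw [h.map_dia, k.map_dia]

/-- Finite S5-algebras. -/
structure FinS5Alg : Type (u + 1) where
  carrier : Type u
  [alg : S5Algebra carrier]
  [fin : Finite carrier]

attribute [instance] FinS5Alg.alg FinS5Alg.fin

/-- The category of finite S5-algebras and their homomorphisms. -/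
instance FinS5Alg.category : Category.{u} FinS5Alg.{u} where
  Hom A B := S5Hom A.carrier B.carrier
  id A := S5Hom.id A.carrier
  comp h k := h.comp k

/- ### The multi-sorted language with sorts the positive natural numbers and, for each surjection
`f : {1, …, m} → {1, …, n}`, a unary function symbol taking arguments of sort `n` to values of
sort `m`. The set `{1, …, n}` is represented by `Fin n`. -/

/-- Surjective functions from an `m`-element set to an `n`-element set. -/
abbrev Surj (m n : ℕ+) : Type := {f : Fin (m : ℕ) → Fin (n : ℕ) // Function.Surjective f}

/-- The identity as a surjection. -/
def Surj.id (n : ℕ+) : Surj n n := ⟨_root_.id, Function.surjective_id⟩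

/-- The composite `g ∘ f` of surjections. -/
def Surj.comp {r m n : ℕ+} (g : Surj m n) (f : Surj r m) : Surj r n :=
  ⟨g.1 ∘ f.1, g.2.comp f.2⟩

/-- A permutation as a surjection. -/
def Surj.ofPerm {n : ℕ+} (σ : Equiv.Perm (Fin (n : ℕ))) : Surj n n := ⟨σ, σ.surjective⟩

/-- Structures for the language; the domains of the sorts may be empty. -/
structure LStr : Type (u + 1) where
  dom : ℕ+ → Type u
  app : ∀ {m n : ℕ+}, Surj m n → dom n → dom m

/-- Homomorphisms of structures. -/
@[ext]
structure LHom (M N : LStr.{u}) : Type u where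
  toFun : ∀ n, M.dom n → N.dom n
  map_app : ∀ {m n : ℕ+} (f : Surj m n) (x : M.dom n),
    toFun m (M.app f x) = N.app f (toFun n x)

/-- The category of structures and homomorphisms. -/
instance LStr.category : Category.{u} LStr.{u} where
  Hom M N := LHom M N
  id M := ⟨fun _ x => x, fun _ _ => rfl⟩
  comp h k := ⟨fun n x => k.toFun n (h.toFun n x), fun f x => by rw [h.map_app, k.map_app]⟩

/- ### First-order formulas of the language -/

/-- Variables of sort `n` in the context `Γ`, a list of sorts (de Bruijn indices). -/
inductive LVar : List ℕ+ → ℕ+ → Type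
  | here {Γ : List ℕ+} {n : ℕ+} : LVar (n :: Γ) n
  | there {Γ : List ℕ+} {k n : ℕ+} : LVar Γ n → LVar (k :: Γ) n

/-- Terms of sort `n` in the context `Γ`. -/
inductive LTerm (Γ : List ℕ+) : ℕ+ → Type
  | var {n : ℕ+} : LVar Γ n → LTerm Γ n
  | app {m n : ℕ+} : Surj m n → LTerm Γ n → LTerm Γ m

/-- First-order formulas in the context `Γ`. -/
inductive LFormula : List ℕ+ → Type
  | falsum {Γ : List ℕ+} : LFormula Γ
  | eq {Γ : List ℕ+} {n : ℕ+} : LTerm Γ n → LTerm Γ n → LFormula Γ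
  | and {Γ : List ℕ+} : LFormula Γ → LFormula Γ → LFormula Γ
  | or {Γ : List ℕ+} : LFormula Γ → LFormula Γ → LFormula Γ
  | imp {Γ : List ℕ+} : LFormula Γ → LFormula Γ → LFormula Γ
  | all {Γ : List ℕ+} (n : ℕ+) : LFormula (n :: Γ) → LFormula Γ
  | ex {Γ : List ℕ+} (n : ℕ+) : LFormula (n :: Γ) → LFormula Γ

/-- Negation. -/
def LFormula.neg {Γ : List ℕ+} (φ : LFormula Γ) : LFormula Γ := φ.imp .falsum

/-- The disjunction of a finite family of formulas (`falsum` for the empty family). -/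
noncomputable def LFormula.finDisj {Γ : List ℕ+} (ι : Type) [Finite ι] (φ : ι → LFormula Γ) :
    LFormula Γ :=
  (((@Finset.univ ι (Fintype.ofFinite ι)).toList).map φ).foldr .or .falsum

/-- The conjunction of a finite family of formulas (truth for the empty family). -/
noncomputable def LFormula.finConj {Γ : List ℕ+} (ι : Type) [Finite ι] (φ : ι → LFormula Γ) :
    LFormula Γ :=
  (((@Finset.univ ι (Fintype.ofFinite ι)).toList).map φ).foldr .and (.neg .falsum)

/-- Assignments of elements of `M` to the variables of a context. -/
def LEnv (M : LStr.{u}) : List ℕ+ → Type u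
  | [] => PUnit
  | n :: Γ => M.dom n × LEnv M Γ

/-- The value of a variable. -/
def LVar.eval (M : LStr.{u}) : {Γ : List ℕ+} → {n : ℕ+} → LVar Γ n → LEnv M Γ → M.dom n
  | _, _, .here, e => e.1
  | _, _, .there v, e => v.eval M e.2

/-- The value of a term. -/
def LTerm.eval (M : LStr.{u}) {Γ : List ℕ+} : {n : ℕ+} → LTerm Γ n → LEnv M Γ → M.dom n
  | _, .var v, e => v.eval M e
  | _, .app f t, e => M.app f (t.eval M e)

/-- Satisfaction of a formula in a structure under an assignment. -/
def LFormula.Sat (M : LStr.{u}) : {Γ : List ℕ+} → LFormula Γ → LEnv M Γ → Prop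
  | _, .falsum, _ => False
  | _, .eq t s, e => t.eval M e = s.eval M e
  | _, .and φ ψ, e => φ.Sat M e ∧ ψ.Sat M e
  | _, .or φ ψ, e => φ.Sat M e ∨ ψ.Sat M e
  | _, .imp φ ψ, e => φ.Sat M e → ψ.Sat M e
  | _, .all n φ, e => ∀ x : M.dom n, φ.Sat M (x, e)
  | _, .ex n φ, e => ∃ x : M.dom n, φ.Sat M (x, e)

/-- A structure is a model of a set of sentences if it satisfies all of them. -/
def LStr.Models (M : LStr.{u}) (T : Set (LFormula [])) : Prop :=
  ∀ φ ∈ T, φ.Sat M PUnit.unit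

/- ### The theory `T₁` -/

/-- There are finitely many surjections out of a given finite set onto sets `{1, …, m}`. -/
instance Surj.finite_sigma (n : ℕ+) : Finite (Σ m : ℕ+, Surj n m) := by
  have hle : ∀ p : (Σ m : ℕ+, Surj n m), p.1 ≤ n := fun p => by
    have h := Fintype.card_le_of_surjective _ p.2.2
    simp only [Fintype.card_fin] at h
    exact_mod_cast h
  have : Finite (Set.Iic n) := (Set.finite_Iic n).to_subtype
  refine Finite.of_injective
    (β := Σ m : Set.Iic n, Surj n m.1) (fun p => ⟨⟨p.1, hle p⟩, p.2⟩) ?_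
  rintro ⟨m, f⟩ ⟨m', f'⟩ h
  rw [Sigma.mk.injEq] at h
  obtain ⟨h1, h2⟩ := h
  obtain rfl : m = m' := congrArg Subtype.val h1
  obtain rfl : f = f' := eq_of_heq h2
  rfl

/-- The formula `Fix(t) = 1`: no permutation other than the identity fixes `t`. -/
noncomputable def LFormula.fixTrivial {Γ : List ℕ+} {n : ℕ+} (t : LTerm Γ n) : LFormula Γ :=
  .finConj {σ : Equiv.Perm (Fin (n : ℕ)) // σ ≠ 1} fun σ =>
    .neg (.eq (.app (Surj.ofPerm σ.1) t) t)

/-- `∀ x, 1(x) = x`. -/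
def axiomId (n : ℕ+) : LFormula [] :=
  .all n (.eq (.app (Surj.id n) (.var .here)) (.var .here))

/-- `∀ x, f(g(x)) = (g ∘ f)(x)`. -/
def axiomComp {r m n : ℕ+} (f : Surj r m) (g : Surj m n) : LFormula [] :=
  .all n (.eq (.app f (.app g (.var .here))) (.app (g.comp f) (.var .here)))

/-- `∀ x, ⋁ { ∃ y, f(y) = x ∧ Fix(y) = 1 | f : {1, …, n} → {1, …, m} }`,
where `m` varies too. -/
noncomputable def axiomCover (n : ℕ+) : LFormula [] :=
  .all n (.finDisj (Σ m : ℕ+, Surj n m) fun p =>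
    .ex p.1 (.and (.eq (.app p.2 (.var .here)) (.var (.there .here)))
      (.fixTrivial (.var .here))))

/-- `∀ x y, f(x) = g(y) ∧ Fix(x) = 1 ∧ Fix(y) = 1 → ⋁ { σ(y) = x | σ ∘ f = g }`, where `σ` varies
over the bijections `{1, …, n} → {1, …, m}`. -/
noncomputable def axiomUnique {k n m : ℕ+} (f : Surj k n) (g : Surj k m) : LFormula [] :=
  .all n (.all m (.imp
    (.and (.eq (.app f (.var (.there .here))) (.app g (.var .here)))
      (.and (.fixTrivial (.var (.there .here))) (.fixTrivial (.var .here))))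
    (.finDisj {σ : Surj n m // Function.Bijective σ.1 ∧ σ.comp f = g} fun σ =>
      .eq (.app σ.1 (.var .here)) (.var (.there .here)))))

/-- The theory `T₁`. -/
def T₁ : Set (LFormula []) :=
  {φ | (∃ n : ℕ+, φ = axiomId n) ∨
    (∃ (r m n : ℕ+) (f : Surj r m) (g : Surj m n), φ = axiomComp f g) ∨
    (∃ n : ℕ+, φ = axiomCover n) ∨
    (∃ (k n m : ℕ+) (f : Surj k n) (g : Surj k m), φ = axiomUnique f g)}

/-- The property of being a model of `T₁`. -/
def isT₁Model : ObjectProperty LStr.{u} := fun M => M.Models T₁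

/-- The category of models of `T₁`, with the homomorphisms of structures. -/
abbrev T₁Model : Type (u + 1) := isT₁Model.{u}.FullSubcategory

/- Unfolding of the satisfaction relation for `T₁`. -/

theorem LFormula.sat_finDisj (M : LStr.{u}) {Γ : List ℕ+} (ι : Type) [Finite ι]
    (φ : ι → LFormula Γ) (e : LEnv M Γ) :
    (LFormula.finDisj ι φ).Sat M e ↔ ∃ i, (φ i).Sat M e := by
  have key : ∀ l : List ι, LFormula.Sat M ((l.map φ).foldr LFormula.or LFormula.falsum) e ↔ ∃ i ∈ l, (φ i).Sat M e := by
    intro l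
    induction l with
    | nil => simp [LFormula.Sat]
    | cons a l ih => simp [LFormula.Sat, ih]
  simp [LFormula.finDisj, key]

theorem LFormula.sat_finConj (M : LStr.{u}) {Γ : List ℕ+} (ι : Type) [Finite ι]
    (φ : ι → LFormula Γ) (e : LEnv M Γ) :
    (LFormula.finConj ι φ).Sat M e ↔ ∀ i, (φ i).Sat M e := by
  have key : ∀ l : List ι,
      LFormula.Sat M ((l.map φ).foldr LFormula.and (LFormula.neg LFormula.falsum)) e ↔ ∀ i ∈ l, (φ i).Sat M e := by
    intro l
    induction l with
    | nil => simp [LFormula.Sat, LFormula.neg]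
    | cons a l ih => simp [LFormula.Sat, ih]
  simp [LFormula.finConj, key]

/-- In a structure, `x` is fixed by no permutation other than the identity. -/
def LStr.FixTrivial (M : LStr.{u}) {n : ℕ+} (x : M.dom n) : Prop :=
  ∀ σ : Equiv.Perm (Fin (n : ℕ)), σ ≠ 1 → M.app (Surj.ofPerm σ) x ≠ x

theorem LFormula.sat_fixTrivial (M : LStr.{u}) {Γ : List ℕ+} {n : ℕ+} (t : LTerm Γ n)
    (e : LEnv M Γ) : (LFormula.fixTrivial t).Sat M e ↔ M.FixTrivial (t.eval M e) := by
  simp [LFormula.fixTrivial, LFormula.sat_finConj, LFormula.neg, LFormula.Sat, LTerm.eval,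
    LStr.FixTrivial]

theorem isT₁Model_iff (M : LStr.{u}) : isT₁Model M ↔
    (∀ (n : ℕ+) (x : M.dom n), M.app (Surj.id n) x = x) ∧
    (∀ (r m n : ℕ+) (f : Surj r m) (g : Surj m n) (x : M.dom n),
      M.app f (M.app g x) = M.app (g.comp f) x) ∧
    (∀ (n : ℕ+) (x : M.dom n), ∃ (m : ℕ+) (f : Surj n m) (y : M.dom m),
      M.app f y = x ∧ M.FixTrivial y) ∧
    (∀ (k n m : ℕ+) (f : Surj k n) (g : Surj k m) (x : M.dom n) (y : M.dom m),
      M.app f x = M.app g y → M.FixTrivial x → M.FixTrivial y →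
      ∃ σ : Surj n m, Function.Bijective σ.1 ∧ σ.comp f = g ∧ M.app σ y = x) := by
  have h1 : ∀ n : ℕ+, (axiomId n).Sat M PUnit.unit ↔
      ∀ x : M.dom n, M.app (Surj.id n) x = x := fun n => Iff.rfl
  have h2 : ∀ (r m n : ℕ+) (f : Surj r m) (g : Surj m n),
      (axiomComp f g).Sat M PUnit.unit ↔
      ∀ x : M.dom n, M.app f (M.app g x) = M.app (g.comp f) x := fun _ _ _ _ _ => Iff.rfl
  have h3 : ∀ n : ℕ+, (axiomCover n).Sat M PUnit.unit ↔
      ∀ x : M.dom n, ∃ (m : ℕ+) (f : Surj n m) (y : M.dom m),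
        M.app f y = x ∧ M.FixTrivial y := fun n => by
    refine forall_congr' fun x => (LFormula.sat_finDisj M _ _ _).trans ?_
    rw [Sigma.exists]
    refine exists_congr fun m => exists_congr fun f => exists_congr fun y => ?_
    exact and_congr Iff.rfl (LFormula.sat_fixTrivial M _ _)
  have h4 : ∀ (k n m : ℕ+) (f : Surj k n) (g : Surj k m),
      (axiomUnique f g).Sat M PUnit.unit ↔ ∀ (x : M.dom n) (y : M.dom m),
      M.app f x = M.app g y → M.FixTrivial x → M.FixTrivial y →
      ∃ σ : Surj n m, Function.Bijective σ.1 ∧ σ.comp f = g ∧ M.app σ y = x :=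
    fun k n m f g => by
      refine forall_congr' fun x => forall_congr' fun y => Iff.trans ?_
        (and_imp.trans (forall_congr' fun _ => and_imp))
      refine imp_congr (and_congr Iff.rfl (and_congr
        (LFormula.sat_fixTrivial M _ _) (LFormula.sat_fixTrivial M _ _))) ?_
      refine (LFormula.sat_finDisj M _ _ _).trans (Subtype.exists.trans ?_)
      refine exists_congr fun σ => ?_
      exact ⟨fun ⟨b, h⟩ => ⟨b.1, b.2, h⟩, fun ⟨a, b, h⟩ => ⟨⟨a, b⟩, h⟩⟩
  constructor
  · intro h
    exact ⟨fun n => (h1 n).1 (h _ (.inl ⟨n, rfl⟩)),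
      fun r m n f g => (h2 r m n f g).1 (h _ (.inr (.inl ⟨r, m, n, f, g, rfl⟩))),
      fun n => (h3 n).1 (h _ (.inr (.inr (.inl ⟨n, rfl⟩)))),
      fun k n m f g => (h4 k n m f g).1 (h _ (.inr (.inr (.inr ⟨k, n, m, f, g, rfl⟩))))⟩
  · rintro ⟨a, b, c, d⟩ φ (⟨n, rfl⟩ | ⟨r, m, n, f, g, rfl⟩ | ⟨n, rfl⟩ | ⟨k, n, m, f, g, rfl⟩)
    · exact (h1 n).2 (a n)
    · exact (h2 r m n f g).2 (b r m n f g)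
    · exact (h3 n).2 (c n)
    · exact (h4 k n m f g).2 (d k n m f g)

/- ### The structure in the category of finite S5-algebras that classifies -/

/-- The powerset of `{1, …, n}` as an S5-algebra, for the total relation on `{1, …, n}`: a subset
is possible everywhere if it is nonempty and nowhere if it is empty. -/
instance powS5Algebra (n : ℕ+) : S5Algebra (Set (ULift.{u} (Fin (n : ℕ)))) where
  dia s := {_x | ∃ y, y ∈ s}
  dia_bot := by ext x; simp
  dia_sup s t := by ext x; simp [exists_or]
  le_dia s x hx := ⟨x, hx⟩
  dia_dia_le s x hx := by
    obtain ⟨_, h⟩ := hx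
    exact h
  le_compl_dia_compl_dia s x hx h := by
    obtain ⟨_, h⟩ := h
    exact h ⟨x, hx⟩

/-- The powerset of `{1, …, n}` as a finite S5-algebra. -/
def powAlg (n : ℕ+) : FinS5Alg.{u} := ⟨Set (ULift.{u} (Fin (n : ℕ)))⟩

/-- A surjection `f : {1, …, m} → {1, …, n}` induces the inverse image homomorphism from the
powerset of `{1, …, n}` to the powerset of `{1, …, m}`. -/
def powHom {m n : ℕ+} (f : Surj m n) :
    S5Hom (Set (ULift.{u} (Fin (n : ℕ)))) (Set (ULift.{u} (Fin (m : ℕ)))) where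
  toFun s := {i | ULift.up (f.1 i.down) ∈ s}
  map_bot := rfl
  map_top := rfl
  map_sup _ _ := rfl
  map_inf _ _ := rfl
  map_dia s := by
    ext i
    constructor
    · rintro ⟨⟨y⟩, hy⟩
      obtain ⟨x, rfl⟩ := f.2 y
      exact ⟨⟨x⟩, hy⟩
    · rintro ⟨x, hx⟩
      exact ⟨_, hx⟩

/-- The inverse image homomorphism as a morphism of finite S5-algebras. -/
def powMap {m n : ℕ+} (f : Surj m n) : powAlg.{u} n ⟶ powAlg.{u} m := powHom f

/-- The evaluation functor: a set-valued functor `F` on finite S5-algebras is sent to the structure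
whose domain of sort `n` is the value of `F` at the powerset of `{1, …, n}`, with the function
symbols interpreted by the values of `F` at inverse image homomorphisms. -/
def evalStr : (FinS5Alg.{u} ⥤ Type u) ⥤ LStr.{u} where
  obj F := ⟨fun n => F.obj (powAlg n), fun f x => F.map (powMap f) x⟩
  map {F G} α := ⟨fun n x => α.app (powAlg n) x, fun {m n} f x => by
    exact ConcreteCategory.congr_hom (α.naturality (powMap f)) x⟩

/- ### Homomorphisms of S5-algebras -/

/-! The proof rests on duality: a finite S5-algebra is the powerset of its atoms, and the modality
is an equivalence relation on them (`S5Algebra.atomSetoid`). Hence each finite algebra is a finite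
product of powersets `powAlg (d i)`, one for each class, and every homomorphism to a `powAlg n` is a
projection followed by the inverse image along a surjection (`FinS5Alg.exists_decomposition`). A lex
functor is therefore determined by its values on the `powAlg n` and the maps `powMap f`, and the
same holds for natural transformations; this gives full faithfulness.

The values form a model because finite limits turn coequalizers and pushouts of surjections into
conditions on elements. An element descended along a surjection with codomain of least size can have
no nontrivial stabilizer, by coequalizers; this is the covering axiom. Two such descents of one
element have a common descent along the pushout, whose legs must be bijective; this is the
uniqueness axiom (`isT₁Model_evalStr`).

Conversely, these two axioms say that a model is a disjoint union of representables, with one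
summand for each class of elements with trivial stabilizer (`isT₁Model.exists_iso_coprodRep`). Such
a union is realized by the finitely supported homomorphisms out of the powerset of `Σ i, Fin (d i)`;
they form a lex functor whose values at the `powAlg n` are again that union (`coprodRepFunctor`,
`coprodRepPoint_bijective`). -/

/-- The function underlying a morphism of finite S5-algebras. -/
abbrev FinS5Alg.fn {A B : FinS5Alg.{u}} (f : A ⟶ B) : A.carrier → B.carrier := S5Hom.toFun f

theorem FinS5Alg.hom_ext {A B : FinS5Alg.{u}} {f g : A ⟶ B} (h : ∀ a, fn f a = fn g a) : f = g :=
  S5Hom.ext (funext h)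

theorem FinS5Alg.fn_comp {A B C : FinS5Alg.{u}} (f : A ⟶ B) (g : B ⟶ C) (a : A.carrier) :
    fn (f ≫ g) a = fn g (fn f a) := rfl

theorem S5Hom.map_compl {A B : Type u} [S5Algebra A] [S5Algebra B] (f : S5Hom A B) (a : A) :
    f.toFun aᶜ = (f.toFun a)ᶜ := by
  refine eq_compl_iff_isCompl.2 (IsCompl.of_eq ?_ ?_)
  · rw [← f.map_inf, compl_inf_eq_bot, f.map_bot]
  · rw [← f.map_sup, compl_sup_eq_top, f.map_top]

theorem S5Hom.mono {A B : Type u} [S5Algebra A] [S5Algebra B] (f : S5Hom A B) {a b : A}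
    (h : a ≤ b) : f.toFun a ≤ f.toFun b := by
  rw [← inf_eq_left, ← f.map_inf, inf_eq_left.2 h]

/-- A family of homomorphisms out of `A` such that each element of `B` has coordinates for exactly
one element of `A` lifts homomorphisms into its components. -/
noncomputable def S5Hom.liftOfJoint {J : Type*} {X A : Type u} {B : J → Type u}
    [S5Algebra X] [S5Algebra A] [∀ j, S5Algebra (B j)]
    (π : ∀ j, S5Hom A (B j)) (inj : ∀ a b, (∀ j, (π j).toFun a = (π j).toFun b) → a = b)
    (ψ : ∀ j, S5Hom X (B j)) (h : ∀ x, ∃ a, ∀ j, (π j).toFun a = (ψ j).toFun x) : S5Hom X A where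
  toFun x := (h x).choose
  map_bot := inj _ _ fun j => by rw [(h _).choose_spec j, (π j).map_bot, (ψ j).map_bot]
  map_top := inj _ _ fun j => by rw [(h _).choose_spec j, (π j).map_top, (ψ j).map_top]
  map_sup x y := inj _ _ fun j => by
    rw [(h _).choose_spec j, (π j).map_sup, (ψ j).map_sup, (h x).choose_spec j,
      (h y).choose_spec j]
  map_inf x y := inj _ _ fun j => by
    rw [(h _).choose_spec j, (π j).map_inf, (ψ j).map_inf, (h x).choose_spec j,
      (h y).choose_spec j]
  map_dia x := inj _ _ fun j => by
    rw [(h _).choose_spec j, (π j).map_dia, (ψ j).map_dia, (h x).choose_spec j]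

/- ### Finite limits of finite S5-algebras -/

section Limits

variable {J : Type} [SmallCategory J]

/-- The compatible families of elements of a diagram of finite S5-algebras. -/
def FinS5Alg.Compat {J : Type*} [Category J] (K : J ⥤ FinS5Alg.{u})
    (a : ∀ j, (K.obj j).carrier) : Prop :=
  ∀ ⦃i j : J⦄ (f : i ⟶ j), fn (K.map f) (a i) = a j

/-- A cone of finite S5-algebras is a limit if its elements are the compatible families. -/
noncomputable def FinS5Alg.isLimitOfCompat {J : Type*} [Category J] {K : J ⥤ FinS5Alg.{u}}
    (c : Cone K)
    (inj : ∀ a b : c.pt.carrier, (∀ j, fn (c.π.app j) a = fn (c.π.app j) b) → a = b)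
    (surj : ∀ a, Compat K a → ∃ x : c.pt.carrier, ∀ j, fn (c.π.app j) x = a j) : IsLimit c where
  lift s := S5Hom.liftOfJoint (fun j => c.π.app j) inj (fun j => s.π.app j) fun x =>
    surj (fun j => fn (s.π.app j) x) fun i j f => by rw [← fn_comp, s.w]
  fac s j := hom_ext fun x => Exists.choose_spec (surj (fun j => fn (s.π.app j) x) fun i j f => by
    rw [← fn_comp, s.w]) j
  uniq s m hm := hom_ext fun x => inj _ _ fun j =>
    (congrArg (fun k => fn k x) (hm j)).trans
      (Exists.choose_spec (surj (fun j => fn (s.π.app j) x) fun i j f => by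
        rw [← fn_comp, s.w]) j).symm

/-- The carrier of the limit of a diagram of finite S5-algebras. -/
@[ext]
structure FinS5Alg.Sec (K : J ⥤ FinS5Alg.{u}) : Type u where
  val : ∀ j, (K.obj j).carrier
  compat : Compat K val

namespace FinS5Alg.Sec

variable (K : J ⥤ FinS5Alg.{u})

instance : Max (Sec K) := ⟨fun a b => ⟨a.val ⊔ b.val, fun i j f => by
  rw [Pi.sup_apply, Pi.sup_apply, ← a.compat f, ← b.compat f]; exact S5Hom.map_sup _ _ _⟩⟩
instance : Min (Sec K) := ⟨fun a b => ⟨a.val ⊓ b.val, fun i j f => by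
  rw [Pi.inf_apply, Pi.inf_apply, ← a.compat f, ← b.compat f]; exact S5Hom.map_inf _ _ _⟩⟩
instance : Top (Sec K) := ⟨⟨⊤, fun _ _ _ => S5Hom.map_top _⟩⟩
instance : Bot (Sec K) := ⟨⟨⊥, fun _ _ _ => S5Hom.map_bot _⟩⟩
instance : Compl (Sec K) := ⟨fun a => ⟨a.valᶜ, fun i j f => by
  rw [Pi.compl_apply, Pi.compl_apply, ← a.compat f]; exact S5Hom.map_compl _ _⟩⟩
instance : SDiff (Sec K) := ⟨fun a b => a ⊓ bᶜ⟩
instance : HImp (Sec K) := ⟨fun a b => b ⊔ aᶜ⟩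
instance : LE (Sec K) := ⟨fun a b => a.val ≤ b.val⟩
instance : LT (Sec K) := ⟨fun a b => a.val < b.val⟩

instance : BooleanAlgebra (Sec K) :=
  Function.Injective.booleanAlgebra (fun a : Sec K => a.val) (fun _ _ => Sec.ext)
    Iff.rfl Iff.rfl (fun _ _ => rfl) (fun _ _ => rfl) rfl rfl (fun _ => rfl)
    (fun _ _ => sdiff_eq.symm) (fun _ _ => himp_eq.symm)

instance : S5Algebra (Sec K) where
  dia a := ⟨fun j => S5Algebra.dia (a.val j), fun i j f => by
    exact (S5Hom.map_dia _ _).trans (congrArg _ (a.compat f))⟩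
  dia_bot := Sec.ext (funext fun _ => S5Algebra.dia_bot)
  dia_sup _ _ := Sec.ext (funext fun _ => S5Algebra.dia_sup _ _)
  le_dia a j := S5Algebra.le_dia (a.val j)
  dia_dia_le a j := S5Algebra.dia_dia_le (a.val j)
  le_compl_dia_compl_dia a j := S5Algebra.le_compl_dia_compl_dia (a.val j)

instance [Finite J] : Finite (Sec K) :=
  Finite.of_injective (fun a : Sec K => a.val) fun _ _ => Sec.ext

end FinS5Alg.Sec

variable (K : J ⥤ FinS5Alg.{u})

/-- The cone of compatible families of a finite diagram. -/
def FinS5Alg.limCone [Finite J] : Cone K where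
  pt := ⟨Sec K⟩
  π :=
    { app := fun j =>
        { toFun := fun a => a.val j
          map_bot := rfl
          map_top := rfl
          map_sup := fun _ _ => rfl
          map_inf := fun _ _ => rfl
          map_dia := fun _ => rfl }
      naturality := fun _ _ f => hom_ext fun a => (a.compat f).symm }

/-- The cone of compatible families is a limit cone. -/
noncomputable def FinS5Alg.isLimitLimCone [Finite J] : IsLimit (limCone K) :=
  isLimitOfCompat _ (fun _ _ h => Sec.ext (funext h)) fun a ha => ⟨⟨a, ha⟩, fun _ => rfl⟩

end Limits

instance FinS5Alg.hasFiniteLimits : HasFiniteLimits FinS5Alg.{u} where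
  out _ _ _ := ⟨fun K => ⟨⟨⟨limCone K, isLimitLimCone K⟩⟩⟩⟩

/- ### Elements of values of functors that preserve finite limits -/

section Lex

variable (F : FinS5Alg.{u} ⥤ Type u) [PreservesFiniteLimits F]

/-- The hypotheses on elements make `A` the product of the `B i`. Here and in the next two lemmas, a
limit cone recognized on elements is transported by `F` and read off in sets. -/
theorem FinS5Alg.existsUnique_of_product {k : ℕ} {A : FinS5Alg.{u}} {B : Fin k → FinS5Alg.{u}}
    (π : ∀ i, A ⟶ B i) (inj : ∀ a b, (∀ i, fn (π i) a = fn (π i) b) → a = b)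
    (surj : ∀ b : ∀ i, (B i).carrier, ∃ a, ∀ i, fn (π i) a = b i) (y : ∀ i, F.obj (B i)) :
    ∃! x : F.obj A, ∀ i, F.map (π i) x = y i := by
  have hc : IsLimit (Fan.mk A π) := FinS5Alg.isLimitOfCompat _
    (fun a b h => inj a b fun i => h ⟨i⟩) fun a _ => by
      obtain ⟨x, hx⟩ := surj fun i => a ⟨i⟩
      exact ⟨x, fun ⟨i⟩ => hx i⟩
  have h := (Types.isLimit_iff _).1 ⟨isLimitOfPreserves F hc⟩ (fun j => y j.as) (by
    rintro ⟨i⟩ ⟨j⟩ ⟨⟨h⟩⟩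
    obtain rfl : i = j := h
    exact F.map_id_apply _ _)
  obtain ⟨x, hx, hu⟩ := h
  exact ⟨x, fun i => hx ⟨i⟩, fun x' hx' => hu x' fun ⟨i⟩ => hx' i⟩

theorem FinS5Alg.exists_of_equalizer {E A B : FinS5Alg.{u}} (e : E ⟶ A) (f g : A ⟶ B)
    (w : e ≫ f = e ≫ g) (inj : Function.Injective (fn e))
    (surj : ∀ a, fn f a = fn g a → ∃ b, fn e b = a) (x : F.obj A) (hx : F.map f x = F.map g x) :
    ∃ y, F.map e y = x := by
  have hc : IsLimit (Fork.ofι e w) := FinS5Alg.isLimitOfCompat _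
    (fun a b h => inj (h .zero)) fun a ha => by
      have h1 : fn f (a .zero) = a .one := ha WalkingParallelPairHom.left
      have h2 : fn g (a .zero) = a .one := ha WalkingParallelPairHom.right
      obtain ⟨x, hx⟩ := surj _ (h1.trans h2.symm)
      refine ⟨x, ?_⟩
      rintro (_ | _)
      · exact hx
      · exact (congrArg (fn f) hx).trans h1
  obtain ⟨y, hy, -⟩ := Types.unique_of_type_equalizer _ _ (isLimitForkMapOfIsLimit F w hc) x hx
  exact ⟨y, hy⟩

theorem FinS5Alg.exists_of_pullback {P A B C : FinS5Alg.{u}} (p : P ⟶ A) (q : P ⟶ B)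
    (f : A ⟶ C) (g : B ⟶ C) (w : p ≫ f = q ≫ g)
    (inj : ∀ a b, fn p a = fn p b → fn q a = fn q b → a = b)
    (surj : ∀ a b, fn f a = fn g b → ∃ c, fn p c = a ∧ fn q c = b)
    (x : F.obj A) (y : F.obj B) (h : F.map f x = F.map g y) :
    ∃ z, F.map p z = x ∧ F.map q z = y := by
  have hc : IsLimit (PullbackCone.mk p q w) := FinS5Alg.isLimitOfCompat _
    (fun a b h => inj a b (h .left) (h .right)) fun a ha => by
      have h1 : fn f (a .left) = a .one := ha WalkingCospan.Hom.inl
      have h2 : fn g (a .right) = a .one := ha WalkingCospan.Hom.inr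
      obtain ⟨x, hx, hy⟩ := surj _ _ (h1.trans h2.symm)
      refine ⟨x, ?_⟩
      rintro (_ | _ | _)
      · exact (congrArg (fn f) hx).trans h1
      · exact hx
      · exact hy
  exact Types.exists_of_isPullback ((IsPullback.of_isLimit' ⟨w⟩ hc).map F) x y h

end Lex

/- ### Duality for finite S5-algebras -/

/-- A homomorphism to a powerset with finite support is evaluated by a family of atoms: if `T` is
a finite set of atoms whose join is sent to the whole set, each point picks one of them. -/
theorem exists_atom_iff_le {A : Type*} [BooleanAlgebra A] {Y : Type*} (φ : A → Set Y)
    (map_bot : φ ⊥ = ∅) (map_sup : ∀ a b, φ (a ⊔ b) = φ a ∪ φ b)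
    (map_inf : ∀ a b, φ (a ⊓ b) = φ a ∩ φ b) (T : Finset A) (hT : ∀ a ∈ T, IsAtom a)
    (y : Y) (hy : y ∈ φ (T.sup _root_.id)) : ∃ a, IsAtom a ∧ ∀ b, y ∈ φ b ↔ a ≤ b := by
  have key : ∃ a ∈ T, y ∈ φ a := by
    clear hT
    induction T using Finset.cons_induction with
    | empty => simp [map_bot] at hy
    | cons a T ha ih =>
      rw [Finset.sup_cons, map_sup] at hy
      rcases hy with hy | hy
      · exact ⟨a, by simp, hy⟩
      · obtain ⟨b, hb, h⟩ := ih hy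
        exact ⟨b, by simp [hb], h⟩
  obtain ⟨a, ha, hya⟩ := key
  refine ⟨a, hT a ha, fun b => ⟨fun hb => ?_, fun hb => ?_⟩⟩
  · have h : a ⊓ b ≠ ⊥ := fun h => by
      have : y ∈ φ (a ⊓ b) := by rw [map_inf]; exact ⟨hya, hb⟩
      rw [h, map_bot] at this
      exact this
    rw [← inf_eq_left]
    exact ((hT a ha).le_iff.1 inf_le_left).resolve_left h
  · rw [← inf_eq_left.2 hb, map_inf] at hya
    exact hya.2

/-! ### Atoms and the accessibility relation between them -/

section Atoms

variable {A : Type u} [S5Algebra A]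

theorem S5Algebra.dia_mono {a b : A} (h : a ≤ b) : dia a ≤ dia b := by
  rw [← sup_eq_right.2 h, dia_sup]
  exact le_sup_left

/-- If the atom `b` were not below `dia a`, it would be below the complement, so that `a ≤ dia (dia
a)ᶜ`; axiom B puts `a` below the complement of this element too. -/
theorem S5Algebra.le_dia_symm {a b : A} (ha : IsAtom a) (hb : IsAtom b) (h : a ≤ dia b) :
    b ≤ dia a := by
  by_contra hn
  have h1 : b ≤ (dia a)ᶜ := by
    rw [le_compl_iff_disjoint_right]
    exact hb.not_le_iff_disjoint.1 hn
  have h2 : a ≤ dia (dia a)ᶜ := h.trans (dia_mono h1)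
  have h3 := le_compl_dia_compl_dia a
  exact ha.1 (le_bot_iff.1 ((le_inf h2 h3).trans inf_compl_eq_bot.le))

variable (A)

/-- The accessibility relation between atoms. -/
def S5Algebra.atomSetoid : Setoid {a : A // IsAtom a} where
  r a b := a.1 ≤ dia b.1
  iseqv :=
    { refl := fun a => le_dia a.1
      symm := fun {a b} h => le_dia_symm a.2 b.2 h
      trans := fun {_ _ _} h k => (h.trans (dia_mono k)).trans (dia_dia_le _) }

variable {A}

theorem S5Algebra.finset_sup_atoms (T : Finset {a : A // IsAtom a})
    (a : {a : A // IsAtom a}) : a.1 ≤ T.sup Subtype.val ↔ a ∈ T := by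
  refine ⟨fun h => ?_, fun h => Finset.le_sup (f := Subtype.val) h⟩
  by_contra hn
  have : Disjoint a.1 (T.sup Subtype.val) := by
    rw [Finset.disjoint_sup_right]
    intro b hb
    exact a.2.disjoint_of_ne b.2 fun hab => hn (Subtype.ext hab ▸ hb)
  exact a.2.1 (disjoint_self.1 (this.mono_right h))

theorem S5Algebra.le_of_atoms [Finite A] {a b : A} (h : ∀ c, IsAtom c → c ≤ a → c ≤ b) :
    a ≤ b := by
  rw [← disjoint_compl_right_iff, disjoint_iff]
  by_contra hn
  obtain ⟨c, hc, hca⟩ := (eq_bot_or_exists_atom_le (a ⊓ bᶜ)).resolve_left hn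
  have h1 := h c hc (hca.trans inf_le_left)
  exact hc.1 (le_bot_iff.1 ((le_inf h1 (hca.trans inf_le_right)).trans inf_compl_eq_bot.le))

theorem S5Algebra.atom_le_sup {a b c : A} (hc : IsAtom c) : c ≤ a ⊔ b ↔ c ≤ a ∨ c ≤ b := by
  refine ⟨fun h => ?_, fun h => h.elim (fun h => h.trans le_sup_left) fun h => h.trans le_sup_right⟩
  by_contra! hn
  have h1 := hc.not_le_iff_disjoint.1 hn.1
  have h2 := hc.not_le_iff_disjoint.1 hn.2
  exact hc.1 (disjoint_self.1 ((h1.sup_right h2).mono_right h))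

/-- By finiteness `a` is the join of the atoms below it; `dia` distributes over this join, and the
atom `c` is join-prime. -/
theorem S5Algebra.atom_le_dia [Finite A] {a c : A} (hc : IsAtom c) :
    c ≤ dia a ↔ ∃ b, IsAtom b ∧ b ≤ a ∧ c ≤ dia b := by
  refine ⟨fun h => ?_, fun ⟨b, _, hb, h⟩ => h.trans (dia_mono hb)⟩
  classical
  have := Fintype.ofFinite A
  have hsup : a ≤ (Finset.univ.filter fun b => IsAtom b ∧ b ≤ a).sup _root_.id :=
    le_of_atoms fun b hb hba => Finset.le_sup (f := _root_.id) (by simp [hb, hba])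
  have key : ∀ T : Finset A, c ≤ dia (T.sup _root_.id) → ∃ b ∈ T, c ≤ dia b := fun T => by
    induction T using Finset.cons_induction with
    | empty =>
      intro h
      rw [Finset.sup_empty, dia_bot] at h
      exact absurd (le_bot_iff.1 h) hc.1
    | cons b T hb ih =>
      intro h
      rw [Finset.sup_cons, dia_sup, atom_le_sup hc] at h
      rcases h with h | h
      · exact ⟨b, by simp, h⟩
      · obtain ⟨d, hd, h⟩ := ih h
        exact ⟨d, by simp [hd], h⟩
  obtain ⟨b, hb, h⟩ := key _ (h.trans (dia_mono hsup))
  simp only [Finset.mem_filter, Finset.mem_univ, true_and] at hb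
  exact ⟨b, hb.1, hb.2, h⟩

end Atoms

/-- For each `y` the sets `s` with `y ∈ φ s` form an ultrafilter. It contains the finite set `S`, so
it is principal, and `f y` is its generator. `X` may be infinite, as is needed for
`coprodRepFunctor`. -/
theorem exists_eq_preimage {X Y : Type*} (φ : Set X → Set Y) (map_bot : φ ⊥ = ⊥)
    (map_sup : ∀ a b, φ (a ⊔ b) = φ a ⊔ φ b) (map_inf : ∀ a b, φ (a ⊓ b) = φ a ⊓ φ b)
    {S : Set X} (hS : S.Finite) (hφ : φ S = ⊤) : ∃ f : Y → X, ∀ s y, y ∈ φ s ↔ f y ∈ s := by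
  classical
  have h : ∀ y, ∃ x, ∀ s, y ∈ φ s ↔ x ∈ s := fun y => by
    obtain ⟨a, ha, h⟩ := exists_atom_iff_le φ map_bot map_sup map_inf
      (hS.toFinset.image fun x => {x}) (fun a ha => by
        obtain ⟨x, -, rfl⟩ := Finset.mem_image.1 ha
        exact Set.isAtom_singleton x) y (by
        have : (hS.toFinset.image fun x => ({x} : Set X)).sup _root_.id = S := by
          ext x
          simp [Finset.sup_eq_iSup]
        rw [this, hφ]
        trivial)
    obtain ⟨x, rfl⟩ := Set.isAtom_iff.1 ha
    exact ⟨x, fun s => (h s).trans Set.singleton_subset_iff⟩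
  choose f hf using h
  exact ⟨f, fun s y => hf y s⟩

/-- The function underlying a homomorphism to a powerset. -/
abbrev FinS5Alg.powFn {A : FinS5Alg.{u}} {n : ℕ+} (φ : A ⟶ powAlg.{u} n) :
    A.carrier → Set (ULift.{u} (Fin (n : ℕ))) := S5Hom.toFun φ

theorem FinS5Alg.mem_powFn_dia {A : FinS5Alg.{u}} {n : ℕ+} (φ : A ⟶ powAlg.{u} n) (a : A.carrier)
    (y : ULift.{u} (Fin (n : ℕ))) : y ∈ powFn φ (S5Algebra.dia a) ↔ ∃ y', y' ∈ powFn φ a :=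
  iff_of_eq (congrArg (fun s : Set (ULift.{u} (Fin (n : ℕ))) => y ∈ s) (S5Hom.map_dia φ a))

/-- Each homomorphism between powersets is the inverse image homomorphism of a surjection. -/
theorem exists_eq_powMap {m n : ℕ+} (φ : powAlg.{u} n ⟶ powAlg.{u} m) :
    ∃ f : Surj m n, φ = powMap f := by
  obtain ⟨f, hf⟩ := exists_eq_preimage (FinS5Alg.powFn φ) (S5Hom.map_bot _) (S5Hom.map_sup _)
    (S5Hom.map_inf _) Set.finite_univ (S5Hom.map_top φ)
  refine ⟨⟨fun y => (f ⟨y⟩).down, fun x => ?_⟩, FinS5Alg.hom_ext fun s => Set.ext (hf s)⟩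
  -- Surjectivity comes from preservation of `dia`: since `dia {x}` is everything, the preimage of
  -- `{x}` is nonempty.
  have h0 : f ⟨⟨0, m.pos⟩⟩ ∈ S5Algebra.dia ({⟨x⟩} : Set (ULift.{u} (Fin (n : ℕ)))) := ⟨_, rfl⟩
  obtain ⟨y, hy⟩ := (FinS5Alg.mem_powFn_dia φ _ _).1 ((hf _ _).2 h0)
  exact ⟨y.down, congrArg ULift.down ((hf _ _).1 hy)⟩

/-- A nonempty finite type is equivalent to one of the standard ones. -/
theorem exists_equiv_fin_pnat (X : Type*) [Finite X] [Nonempty X] :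
    ∃ n : ℕ+, Nonempty (Fin (n : ℕ) ≃ X) :=
  ⟨⟨Nat.card X, Nat.card_pos⟩, ⟨(Finite.equivFin X).symm⟩⟩

/-- Each finite S5-algebra is a finite product of powersets, through whose projections each
homomorphism to a powerset factors. -/
theorem FinS5Alg.exists_decomposition (A : FinS5Alg.{u}) :
    ∃ (k : ℕ) (d : Fin k → ℕ+) (π : ∀ i, A ⟶ powAlg.{u} (d i)),
      (∀ a b, (∀ i, fn (π i) a = fn (π i) b) → a = b) ∧
      (∀ b : ∀ i, (powAlg.{u} (d i)).carrier, ∃ a, ∀ i, fn (π i) a = b i) ∧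
      ∀ (n : ℕ+) (φ : A ⟶ powAlg.{u} n), ∃ (i : Fin k) (f : Surj n (d i)), φ = π i ≫ powMap f := by
  classical
  let At := {a : A.carrier // IsAtom a}
  let Q := Quotient (S5Algebra.atomSetoid A.carrier)
  let cls : At → Q := Quotient.mk _
  have hcls : ∀ a b : At, cls a = cls b ↔ a.1 ≤ S5Algebra.dia b.1 := fun a b => Quotient.eq
  obtain ⟨k, ⟨e⟩⟩ := Finite.exists_equiv_fin Q
  have hC : ∀ i : Fin k, ∃ n : ℕ+, Nonempty (Fin (n : ℕ) ≃ {a : At // e (cls a) = i}) := fun i => by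
    have : Nonempty {a : At // e (cls a) = i} := by
      obtain ⟨a, ha⟩ := Quotient.exists_rep (e.symm i)
      exact ⟨⟨a, (Equiv.eq_symm_apply e).1 ha⟩⟩
    exact exists_equiv_fin_pnat _
  choose d ε using hC
  replace ε := fun i => (ε i).some
  -- The projection to the class `i` records which atoms of that class lie below `a`; `ε i`
  -- enumerates the class.
  let pr : ∀ i, A ⟶ powAlg.{u} (d i) := fun i =>
    { toFun := fun a => {j | (ε i j.down).1.1 ≤ a}
      map_bot := Set.ext fun j => iff_false_intro fun h => (ε i j.down).1.2.1 (le_bot_iff.1 h)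
      map_top := Set.ext fun j => iff_true_intro le_top
      map_sup := fun a b => Set.ext fun j => S5Algebra.atom_le_sup (ε i j.down).1.2
      map_inf := fun a b => Set.ext fun j => le_inf_iff
      map_dia := fun a => Set.ext fun j => by
        refine (S5Algebra.atom_le_dia (ε i j.down).1.2).trans ⟨?_, ?_⟩
        · rintro ⟨b, hb, hba, h⟩
          have h1 : e (cls ⟨b, hb⟩) = i :=
            (congrArg e ((hcls _ ⟨b, hb⟩).2 h)).symm.trans (ε i j.down).2
          refine ⟨⟨(ε i).symm ⟨⟨b, hb⟩, h1⟩⟩, ?_⟩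
          simpa using hba
        · rintro ⟨j', h⟩
          refine ⟨_, (ε i j'.down).1.2, h, (hcls _ _).1 (e.injective ?_)⟩
          exact (ε i j.down).2.trans (ε i j'.down).2.symm }
  have hpr : ∀ i (j : ULift.{u} (Fin (d i : ℕ))) (a : A.carrier),
    j ∈ powFn (pr i) a ↔ (ε i j.down).1.1 ≤ a := fun _ _ _ => Iff.rfl
  have hle : ∀ a b, (∀ i, powFn (pr i) a = powFn (pr i) b) → a ≤ b := fun a b h =>
    S5Algebra.le_of_atoms fun c hc hca => by
      have h1 := hpr (e (cls ⟨c, hc⟩)) ⟨(ε _).symm ⟨⟨c, hc⟩, rfl⟩⟩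
      simp only [Equiv.apply_symm_apply] at h1
      rw [← h1, ← h, h1]
      exact hca
  refine ⟨k, d, pr, fun a b h => le_antisymm (hle a b h) (hle b a fun i => (h i).symm),
    fun b => ?_, fun n φ => ?_⟩
  · have := Fintype.ofFinite At
    let b' : ∀ i, Set (ULift.{u} (Fin (d i : ℕ))) := b
    refine ⟨(Finset.univ.filter fun a : At => ⟨(ε _).symm ⟨a, rfl⟩⟩ ∈ b' (e (cls a))).sup
      Subtype.val, fun i => Set.ext fun j => (hpr i j _).trans ?_⟩
    rw [ S5Algebra.finset_sup_atoms, Finset.mem_filter]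
    -- The index of `b'` depends on the atom; stating the equivalence for a general `c` lets its
    -- class be substituted for `i`.
    have : ∀ c : {a : At // e (cls a) = i}, (⟨(ε _).symm ⟨c.1, rfl⟩⟩ ∈ b' (e (cls c.1))) ↔
        (⟨(ε i).symm c⟩ ∈ b' i) := by
      rintro ⟨c, rfl⟩
      rfl
    rw [this]
    simp only [Finset.mem_univ, true_and, Equiv.symm_apply_apply]
    rfl
  · have := Fintype.ofFinite A.carrier
    have ht : ∀ y, ∃ a : At, ∀ b, y ∈ powFn φ b ↔ a.1 ≤ b := fun y => by
      obtain ⟨a, ha, h⟩ := exists_atom_iff_le (powFn φ) (S5Hom.map_bot _) (S5Hom.map_sup _)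
        (S5Hom.map_inf _) (Finset.univ.filter fun a => IsAtom a) (by simp) y (by
          rw [show (Finset.univ.filter fun a : A.carrier => IsAtom a).sup _root_.id = ⊤ from
            top_le_iff.1 (S5Algebra.le_of_atoms fun c hc _ =>
              Finset.le_sup (f := _root_.id) (by simp [hc]))]
          rw [show powFn φ ⊤ = ⊤ from S5Hom.map_top φ]
          trivial)
      exact ⟨⟨a, ha⟩, h⟩
    choose t ht using ht
    -- The right side does not depend on `y`. Thus the atoms `t y` all lie in one class, and every
    -- atom of that class is some `t y`.
    have hdia : ∀ y b, (t y).1 ≤ S5Algebra.dia b ↔ ∃ y', (t y').1 ≤ b := fun y b => by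
      rw [← ht, mem_powFn_dia]
      exact exists_congr fun y' => ht y' b
    let y₀ : ULift.{u} (Fin (n : ℕ)) := ⟨⟨0, n.pos⟩⟩
    have hy₀ : ∀ y, e (cls (t y)) = e (cls (t y₀)) := fun y =>
      congrArg e ((hcls _ _).2 ((hdia _ _).2 ⟨y₀, le_rfl⟩))
    refine ⟨e (cls (t y₀)), ⟨fun y => (ε _).symm ⟨t ⟨y⟩, hy₀ ⟨y⟩⟩, fun j => ?_⟩,
      hom_ext fun a => Set.ext fun y => ?_⟩
    · obtain ⟨c, hc⟩ : ∃ c, ε _ j = c := ⟨_, rfl⟩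
      obtain ⟨y, hy⟩ := (hdia y₀ c.1.1).1 ((hcls _ _).1 (e.injective c.2.symm))
      refine ⟨y.down, (Equiv.symm_apply_eq _).2 (Subtype.ext (Subtype.ext ?_))⟩
      rw [hc]
      exact (c.1.2.le_iff.1 hy).resolve_left (t y).2.1
    · refine (ht y a).trans ?_
      change _ ↔ (ε _ ((ε _).symm ⟨t y, hy₀ y⟩)).1.1 ≤ a
      rw [Equiv.apply_symm_apply]

/- ### Pushouts and coequalizers of surjections -/

/-- The pushout of sets is the quotient of the disjoint union by `f i ∼ g i`. Its universal property
is stated for predicates because, on powersets, this says that inverse images form a pullback. -/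
theorem Surj.exists_pushout {k n m : ℕ+} (f : Surj k n) (g : Surj k m) :
    ∃ (p : ℕ+) (v : Surj n p) (w : Surj m p), v.comp f = w.comp g ∧
      ∀ (P : Fin (n : ℕ) → Prop) (Q : Fin (m : ℕ) → Prop), (∀ i, P (f.1 i) = Q (g.1 i)) →
        ∃ R : Fin (p : ℕ) → Prop, (∀ i, R (v.1 i) = P i) ∧ ∀ j, R (w.1 j) = Q j := by
  let r : Fin (n : ℕ) ⊕ Fin (m : ℕ) → Fin (n : ℕ) ⊕ Fin (m : ℕ) → Prop := fun a b =>
    ∃ i, a = .inl (f.1 i) ∧ b = .inr (g.1 i)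
  have hr : ∀ i, Quot.mk r (.inl (f.1 i)) = Quot.mk r (.inr (g.1 i)) := fun i =>
    Quot.sound ⟨i, rfl, rfl⟩
  have : Nonempty (Quot r) := ⟨Quot.mk r (.inl ⟨0, n.pos⟩)⟩
  obtain ⟨p, ⟨e⟩⟩ := exists_equiv_fin_pnat (Quot r)
  refine ⟨p, ⟨fun i => e.symm (Quot.mk r (.inl i)), e.symm.surjective.comp ?_⟩,
    ⟨fun i => e.symm (Quot.mk r (.inr i)), e.symm.surjective.comp ?_⟩,
    Subtype.ext (funext fun i => congrArg e.symm (hr i)), fun P Q h =>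
      ⟨fun x => Quot.lift (r := r) (Sum.elim P Q) ?_ (e x), fun i => ?_, fun j => ?_⟩⟩
  · rintro ⟨i | j⟩
    · exact ⟨i, rfl⟩
    · obtain ⟨i, rfl⟩ := g.2 j
      exact ⟨f.1 i, hr i⟩
  · rintro ⟨i | j⟩
    · obtain ⟨i, rfl⟩ := f.2 i
      exact ⟨g.1 i, (hr i).symm⟩
    · exact ⟨j, rfl⟩
  · rintro _ _ ⟨i, rfl, rfl⟩
    exact h i
  · simp
  · simp

theorem Surj.exists_coequalizer {k n : ℕ+} (f g : Surj k n) :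
    ∃ (p : ℕ+) (q : Surj n p), q.comp f = q.comp g ∧
      ∀ P : Fin (n : ℕ) → Prop, (∀ i, P (f.1 i) = P (g.1 i)) →
        ∃ R : Fin (p : ℕ) → Prop, ∀ i, R (q.1 i) = P i := by
  let r : Fin (n : ℕ) → Fin (n : ℕ) → Prop := fun a b => ∃ i, a = f.1 i ∧ b = g.1 i
  have : Nonempty (Quot r) := ⟨Quot.mk r ⟨0, n.pos⟩⟩
  obtain ⟨p, ⟨e⟩⟩ := exists_equiv_fin_pnat (Quot r)
  refine ⟨p, ⟨fun i => e.symm (Quot.mk r i), e.symm.surjective.comp Quot.mk_surjective⟩,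
    Subtype.ext (funext fun i => congrArg e.symm (Quot.sound ⟨i, rfl, rfl⟩)), fun P h =>
      ⟨fun x => Quot.lift (r := r) P ?_ (e x), fun i => ?_⟩⟩
  · rintro _ _ ⟨i, rfl, rfl⟩
    exact h i
  · simp

theorem Surj.le {m n : ℕ+} (f : Surj m n) : n ≤ m := by
  have h := Fintype.card_le_of_surjective _ f.2
  simp only [Fintype.card_fin] at h
  exact_mod_cast h

theorem Surj.injective_of_le {m n : ℕ+} (f : Surj m n) (h : m ≤ n) : Function.Injective f.1 := by
  obtain rfl := le_antisymm h f.le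
  exact Finite.injective_iff_surjective.2 f.2

/-- The permutation underlying a bijective endomap. -/
noncomputable def Surj.toPerm {n : ℕ+} (f : Surj n n) : Equiv.Perm (Fin (n : ℕ)) :=
  Equiv.ofBijective f.1 ⟨f.injective_of_le le_rfl, f.2⟩

theorem Surj.ofPerm_toPerm {n : ℕ+} (f : Surj n n) : Surj.ofPerm f.toPerm = f := rfl

theorem Surj.toPerm_eq_one {n : ℕ+} {f : Surj n n} (h : f.toPerm = 1) : f = Surj.id n :=
  (Surj.ofPerm_toPerm f).symm.trans (congrArg Surj.ofPerm h)

/-- The inverse of a bijective map. -/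
noncomputable def Surj.inv {m n : ℕ+} (f : Surj m n) (hf : Function.Bijective f.1) : Surj n m :=
  ⟨(Equiv.ofBijective f.1 hf).symm, (Equiv.ofBijective f.1 hf).symm.surjective⟩

theorem Surj.inv_comp {m n : ℕ+} (f : Surj m n) (hf : Function.Bijective f.1) :
    (f.inv hf).comp f = Surj.id m :=
  Subtype.ext (funext (Equiv.ofBijective f.1 hf).symm_apply_apply)

theorem Surj.comp_inv {m n : ℕ+} (f : Surj m n) (hf : Function.Bijective f.1) :
    f.comp (f.inv hf) = Surj.id n :=
  Subtype.ext (funext (Equiv.ofBijective f.1 hf).apply_symm_apply)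

theorem Surj.inv_bijective {m n : ℕ+} (f : Surj m n) (hf : Function.Bijective f.1) :
    Function.Bijective (f.inv hf).1 :=
  (Equiv.ofBijective f.1 hf).symm.bijective

/- ### Functors that preserve finite limits are models -/

section Model

variable (F : FinS5Alg.{u} ⥤ Type u)

theorem evalStr_app_comp {r m n : ℕ+} (f : Surj r m) (g : Surj m n)
    (x : (evalStr.obj F).dom n) :
    (evalStr.obj F).app f ((evalStr.obj F).app g x) = (evalStr.obj F).app (g.comp f) x :=
  (F.map_comp_apply (powMap g) (powMap f) x).symm

theorem evalStr_app_id {n : ℕ+} (x : (evalStr.obj F).dom n) :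
    (evalStr.obj F).app (Surj.id n) x = x :=
  F.map_id_apply (powAlg n) x

theorem powFn_powMap_injective {m n : ℕ+} (f : Surj m n) :
    Function.Injective (FinS5Alg.powFn (powMap.{u} f)) := by
  rintro (s t : Set (ULift.{u} (Fin (n : ℕ)))) h
  refine Set.ext fun ⟨x⟩ => ?_
  obtain ⟨y, rfl⟩ := f.2 x
  exact Set.ext_iff.1 h ⟨y⟩

/-- If `v` identifies two points, then composing it with their transposition does not change it, so
the transposition fixes the image of `z`. -/
theorem evalStr_bijective_of_fixTrivial {n p : ℕ+} (v : Surj n p) (z : (evalStr.obj F).dom p)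
    (h : (evalStr.obj F).FixTrivial ((evalStr.obj F).app v z)) : Function.Bijective v.1 := by
  refine ⟨fun i j hij => ?_, v.2⟩
  by_contra hne
  refine h (Equiv.swap i j) (fun he => hne (Equiv.swap_eq_one_iff.1 he)) ?_
  rw [evalStr_app_comp]
  congr 1
  refine Subtype.ext (funext fun a => ?_)
  change v.1 (Equiv.swap i j a) = v.1 a
  rw [Equiv.swap_apply_def]
  split_ifs with h1 h2
  · rw [h1, hij]
  · rw [h2, hij]
  · rfl

variable [PreservesFiniteLimits F]

theorem evalStr_exists_of_coequalizer {k n : ℕ+} (f g : Surj k n) :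
    ∃ (p : ℕ+) (q : Surj n p), q.comp f = q.comp g ∧
      ∀ x : (evalStr.obj F).dom n, (evalStr.obj F).app f x = (evalStr.obj F).app g x →
        ∃ y, (evalStr.obj F).app q y = x := by
  obtain ⟨p, q, hq, H⟩ := Surj.exists_coequalizer f g
  refine ⟨p, q, hq, FinS5Alg.exists_of_equalizer F (powMap q) (powMap f) (powMap g)
    (congrArg powMap hq) (powFn_powMap_injective q)
    fun (a : Set (ULift.{u} (Fin (n : ℕ)))) ha => ?_⟩
  obtain ⟨R, hR⟩ := H (fun i => ⟨i⟩ ∈ a) fun i => congrArg (fun s => s ⟨i⟩) ha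
  exact ⟨{i | R i.down}, Set.ext fun i => iff_of_eq (hR i.down)⟩

theorem evalStr_exists_of_pushout {k n m : ℕ+} (f : Surj k n) (g : Surj k m) :
    ∃ (p : ℕ+) (v : Surj n p) (w : Surj m p), v.comp f = w.comp g ∧
      ∀ (x : (evalStr.obj F).dom n) (y : (evalStr.obj F).dom m),
        (evalStr.obj F).app f x = (evalStr.obj F).app g y →
        ∃ z, (evalStr.obj F).app v z = x ∧ (evalStr.obj F).app w z = y := by
  obtain ⟨p, v, w, h, H⟩ := Surj.exists_pushout f g
  refine ⟨p, v, w, h, FinS5Alg.exists_of_pullback F (powMap v) (powMap w) (powMap f) (powMap g)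
    (congrArg powMap h) (fun a b hab _ => powFn_powMap_injective v hab)
    fun (a : Set (ULift.{u} (Fin (n : ℕ)))) (b : Set (ULift.{u} (Fin (m : ℕ)))) hab => ?_⟩
  obtain ⟨R, hR, hR'⟩ := H (fun i => ⟨i⟩ ∈ a) (fun i => ⟨i⟩ ∈ b)
    fun i => congrArg (fun s => s ⟨i⟩) hab
  exact ⟨{i | R i.down}, Set.ext fun i => iff_of_eq (hR i.down),
    Set.ext fun i => iff_of_eq (hR' i.down)⟩

theorem isT₁Model_evalStr : isT₁Model (evalStr.obj F) := by
  refine (isT₁Model_iff _).2 ⟨fun n x => evalStr_app_id F x,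
    fun r m n f g x => evalStr_app_comp F f g x, fun n x => ?_, fun k n m f g x y h hx hy => ?_⟩
  -- Take `m` least such that `x` descends to sort `m`. If `σ` fixes the descended element, that
  -- element descends further along the coequalizer `q` of `σ` and the identity. Minimality makes
  -- `q` injective, so `σ` is the identity.
  · let S : Set ℕ+ := {m | ∃ (f : Surj n m) (y : (evalStr.obj F).dom m),
      (evalStr.obj F).app f y = x}
    obtain ⟨m, ⟨f, y, hy⟩, hm⟩ := WellFounded.has_min (wellFounded_lt (α := ℕ+)) S
      ⟨n, Surj.id n, x, evalStr_app_id F x⟩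
    refine ⟨m, f, y, hy, fun σ hσ hσy => hσ ?_⟩
    obtain ⟨p, q, hq, H⟩ := evalStr_exists_of_coequalizer F (Surj.ofPerm σ) (Surj.id m)
    obtain ⟨z, rfl⟩ := H y (hσy.trans (evalStr_app_id F y).symm)
    have hmp : m ≤ p := not_lt.1 (hm p ⟨q.comp f, z, by rw [← evalStr_app_comp, hy]⟩)
    exact Equiv.ext fun i => q.injective_of_le hmp (congrFun (congrArg Subtype.val hq) i)
  · obtain ⟨p, v, w, hvw, H⟩ := evalStr_exists_of_pushout F f g
    obtain ⟨z, rfl, rfl⟩ := H x y h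
    have hw := evalStr_bijective_of_fixTrivial F w z hy
    -- Both legs of the pushout are bijective, since `x` and `y` are images of `z` with trivial
    -- stabilizer.
    refine ⟨(w.inv hw).comp v, (w.inv_bijective hw).comp
      (evalStr_bijective_of_fixTrivial F v z hx), ?_, ?_⟩
    · change (w.inv hw).comp (v.comp f) = g
      rw [hvw]
      change ((w.inv hw).comp w).comp g = g
      rw [Surj.inv_comp]
      rfl
    · rw [evalStr_app_comp]
      change (evalStr.obj F).app ((w.comp (w.inv hw)).comp v) z = _
      rw [Surj.comp_inv]
      rfl

end Model

/- ### Natural transformations are determined by homomorphisms of structures -/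

section FullyFaithful

variable {F G : FinS5Alg.{u} ⥤ Type u} [PreservesFiniteLimits G]

/-- The product projections from `exists_decomposition` are among the `φ`, and `G` preserves the
product. -/
theorem FinS5Alg.ext_of_powAlg {A : FinS5Alg.{u}} {a b : G.obj A}
    (h : ∀ (n : ℕ+) (φ : A ⟶ powAlg.{u} n), G.map φ a = G.map φ b) : a = b := by
  obtain ⟨k, d, π, inj, surj, -⟩ := A.exists_decomposition
  exact (existsUnique_of_product G π inj surj fun i => G.map (π i) b).unique
    (fun i => h _ (π i)) fun i => rfl

theorem evalStr_map_injective {α β : F ⟶ G} (h : evalStr.map α = evalStr.map β) : α = β := by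
  ext A a
  refine FinS5Alg.ext_of_powAlg fun n φ => ?_
  refine (NatTrans.naturality_apply α φ a).symm.trans
    (Eq.trans ?_ (NatTrans.naturality_apply β φ a))
  exact congrFun (congrFun (congrArg LHom.toFun h) n) _

/-- The product projections prescribe `b`. Any other `φ` is a projection followed by some `powMap
f`, and `h` commutes with `f`. Asking for all `φ`, not only the projections, makes naturality
immediate. -/
theorem exists_extension (h : evalStr.obj F ⟶ evalStr.obj G) {A : FinS5Alg.{u}} (a : F.obj A) :
    ∃ b : G.obj A, ∀ (n : ℕ+) (φ : A ⟶ powAlg.{u} n), G.map φ b = h.toFun n (F.map φ a) := by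
  obtain ⟨k, d, π, inj, surj, H⟩ := A.exists_decomposition
  obtain ⟨b, hb, -⟩ := FinS5Alg.existsUnique_of_product G π inj surj
    fun i => h.toFun (d i) (F.map (π i) a)
  refine ⟨b, fun n φ => ?_⟩
  obtain ⟨i, f, rfl⟩ := H n φ
  rw [G.map_comp_apply, F.map_comp_apply, hb]
  exact (h.map_app f _).symm

theorem evalStr_map_surjective (h : evalStr.obj F ⟶ evalStr.obj G) :
    ∃ α : F ⟶ G, evalStr.map α = h := by
  choose α hα using fun (A : FinS5Alg.{u}) (a : F.obj A) => exists_extension h a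
  refine ⟨{ app := fun A => ↾(α A), naturality := fun A B ψ => ?_ }, ?_⟩
  · ext a
    refine FinS5Alg.ext_of_powAlg fun n φ => ?_
    change G.map φ (α B (F.map ψ a)) = G.map φ (G.map ψ (α A a))
    rw [hα, ← G.map_comp_apply, hα, F.map_comp_apply]
  · refine LHom.ext (funext fun n => funext fun x => ?_)
    refine FinS5Alg.ext_of_powAlg fun m φ => ?_
    refine (hα _ _ _ _).trans ?_
    obtain ⟨f, rfl⟩ := exists_eq_powMap φ
    exact h.map_app f x

end FullyFaithful

/- ### Coproducts of representable structures -/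

/-- A bijective homomorphism of structures is an isomorphism. -/
noncomputable def LStr.isoOfBijective {M N : LStr.{u}} (h : M ⟶ N)
    (hh : ∀ n, Function.Bijective (h.toFun n)) : M ≅ N where
  hom := h
  inv :=
    { toFun := fun n => (Equiv.ofBijective _ (hh n)).symm
      map_app := fun {m n} f x => by
        rw [Equiv.symm_apply_eq]
        refine Eq.trans ?_ (h.map_app f _).symm
        exact congrArg _ ((Equiv.ofBijective _ (hh n)).apply_symm_apply x).symm }
  hom_inv_id := LHom.ext (funext fun n => funext (Equiv.ofBijective _ (hh n)).symm_apply_apply)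
  inv_hom_id := LHom.ext (funext fun n => funext (Equiv.ofBijective _ (hh n)).apply_symm_apply)

/-- The coproduct of the structures represented by the sorts `d i`. -/
def LStr.coprodRep {ι : Type u} (d : ι → ℕ+) : LStr.{u} where
  dom n := Σ i, Surj n (d i)
  app f x := ⟨x.1, x.2.comp f⟩

theorem isT₁Model.app_id {M : LStr.{u}} (hM : isT₁Model M) {n : ℕ+} (x : M.dom n) : M.app (Surj.id n) x = x :=
  ((isT₁Model_iff M).1 hM).1 n x

theorem isT₁Model.app_app {M : LStr.{u}} (hM : isT₁Model M) {r m n : ℕ+}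
    (f : Surj r m) (g : Surj m n) (x : M.dom n) :
    M.app f (M.app g x) = M.app (g.comp f) x :=
  ((isT₁Model_iff M).1 hM).2.1 r m n f g x

/-- The elements of a structure that are fixed by no nontrivial permutation. -/
def LStr.Generic (M : LStr.{u}) : Type u := Σ n : ℕ+, {x : M.dom n // M.FixTrivial x}

/-- Two elements fixed by no nontrivial permutation are equivalent if a bijection sends one to the
other. -/
def LStr.genericSetoid (M : LStr.{u}) (hM : isT₁Model M) : Setoid M.Generic where
  r x y := ∃ σ : Surj x.1 y.1, Function.Bijective σ.1 ∧ M.app σ y.2.1 = x.2.1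
  iseqv :=
    { refl := fun x => ⟨Surj.id _, Function.bijective_id, hM.app_id _⟩
      symm := fun {x y} ⟨σ, hσ, h⟩ => ⟨σ.inv hσ, σ.inv_bijective hσ, by
        rw [← h, hM.app_app, Surj.comp_inv, hM.app_id]⟩
      trans := fun {x y z} ⟨σ, hσ, h⟩ ⟨τ, hτ, k⟩ => ⟨τ.comp σ, hτ.comp hσ, by
        rw [← h, ← k, hM.app_app]⟩ }

/-- Each model is a coproduct of represented structures. -/
theorem isT₁Model.exists_iso_coprodRep {M : LStr.{u}} (hM : isT₁Model M) :
    ∃ (ι : Type u) (d : ι → ℕ+), Nonempty (LStr.coprodRep d ≅ M) := by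
  obtain ⟨-, -, cover, unique⟩ := (isT₁Model_iff M).1 hM
  let ι := Quotient (M.genericSetoid hM)
  let rep : ι → M.Generic := Quotient.out
  let Φ : LStr.coprodRep (fun i => (rep i).1) ⟶ M :=
    { toFun := fun n x => M.app x.2 (rep x.1).2.1
      map_app := fun f x => (hM.app_app f x.2 _).symm }
  refine ⟨ι, fun i => (rep i).1, ⟨LStr.isoOfBijective Φ fun n => ⟨?_, fun x => ?_⟩⟩⟩
  · rintro ⟨i, f⟩ ⟨j, g⟩ h
    -- The bijection `σ` puts the two representatives in one class, so they coincide; then `σ`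
    -- stabilizes a generic element, so it is the identity and `f = g`.
    obtain ⟨σ, hσ, hfg, hσx⟩ := unique _ _ _ f g _ _ h (rep i).2.2 (rep j).2.2
    obtain rfl : i = j := Quotient.out_equiv_out.1 ⟨σ, hσ, hσx⟩
    have h1 : σ.toPerm = 1 := by
      by_contra hn
      exact (rep i).2.2 σ.toPerm hn hσx
    rw [Surj.toPerm_eq_one h1] at hfg
    exact congrArg (Sigma.mk i) hfg
  · obtain ⟨m, f, y, rfl, hy⟩ := cover n x
    obtain ⟨σ, -, h⟩ := (M.genericSetoid hM).symm
      (Quotient.mk_out (s := M.genericSetoid hM) ⟨m, y, hy⟩)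
    exact ⟨⟨_, σ.comp f⟩, (hM.app_app f σ _).symm.trans (congrArg _ h)⟩

/- ### The functor that corresponds to a coproduct of represented structures -/

section Coprod

variable {ι : Type u} (d : ι → ℕ+)

/-- The powerset of a disjoint union of sets `{1, …, n}`, as an S5-algebra for the equivalence
relation of lying in the same summand. -/
instance sigmaS5Algebra : S5Algebra (Set (Σ i, Fin (d i : ℕ))) where
  dia s := {x | ∃ y ∈ s, y.1 = x.1}
  dia_bot := by ext x; simp
  dia_sup s t := by ext x; simp [or_and_right, exists_or]
  le_dia s x hx := ⟨x, hx, rfl⟩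
  dia_dia_le s x hx := by
    obtain ⟨y, ⟨z, hz, hzy⟩, hyx⟩ := hx
    exact ⟨z, hz, hzy.trans hyx⟩
  le_compl_dia_compl_dia s x hx h := by
    obtain ⟨y, hy, hyx⟩ := h
    exact hy ⟨x, hx, hyx.symm⟩

/-- The functor represented by the powerset of a disjoint union of sets `{1, …, n}`, with respect to
the homomorphisms of finite support. -/
def coprodRepFunctor : FinS5Alg.{u} ⥤ Type u where
  obj A := {φ : S5Hom (Set (Σ i, Fin (d i : ℕ))) A.carrier // ∃ S, S.Finite ∧ φ.toFun S = ⊤}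
  map f := ↾fun φ => ⟨φ.1.comp f, by
    obtain ⟨S, hS, h⟩ := φ.2
    exact ⟨S, hS, (congrArg (FinS5Alg.fn f) h).trans (S5Hom.map_top f)⟩⟩

theorem coprodRepFunctor_ext {A : FinS5Alg.{u}} {φ ψ : (coprodRepFunctor d).obj A}
    (h : ∀ s, φ.1.toFun s = ψ.1.toFun s) : φ = ψ :=
  Subtype.ext (S5Hom.ext (funext h))

/-- A compatible family of homomorphisms is a homomorphism into the algebra of compatible families.
The union of the supports supports it, and is finite because the diagram has finitely many objects.
-/
instance coprodRepFunctor_preservesFiniteLimits :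
    PreservesFiniteLimits (coprodRepFunctor d) where
  preservesFiniteLimits J _ _ := ⟨fun {K} =>
    preservesLimit_of_preserves_limit_cone (FinS5Alg.isLimitLimCone K) (by
      refine Nonempty.some ((Types.isLimit_iff _).2 fun s hs => ?_)
      let ψ : ∀ j, (coprodRepFunctor d).obj (K.obj j) := s
      have hψ : ∀ a, FinS5Alg.Compat K fun j => (ψ j).1.toFun a := fun a i j f =>
        congrArg (fun φ : (coprodRepFunctor d).obj (K.obj j) => φ.1.toFun a) (hs f)
      choose S hS hS' using fun j => (ψ j).2
      refine ⟨⟨⟨fun a => ⟨_, hψ a⟩, ?_, ?_, ?_, ?_, ?_⟩, ⋃ j, S j, Set.finite_iUnion hS, ?_⟩,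
        fun j => rfl, fun φ hφ => ?_⟩
      · exact FinS5Alg.Sec.ext (funext fun j => (ψ j).1.map_bot)
      · exact FinS5Alg.Sec.ext (funext fun j => (ψ j).1.map_top)
      · exact fun a b => FinS5Alg.Sec.ext (funext fun j => (ψ j).1.map_sup a b)
      · exact fun a b => FinS5Alg.Sec.ext (funext fun j => (ψ j).1.map_inf a b)
      · exact fun a => FinS5Alg.Sec.ext (funext fun j => (ψ j).1.map_dia a)
      · exact FinS5Alg.Sec.ext (funext fun j =>
          top_le_iff.1 ((hS' j).ge.trans ((ψ j).1.mono (Set.subset_iUnion S j))))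
      · exact coprodRepFunctor_ext d fun a => FinS5Alg.Sec.ext (funext fun j =>
          congrArg (fun φ : (coprodRepFunctor d).obj (K.obj j) => φ.1.toFun a) (hφ j)))⟩

/-- The inverse image homomorphism of a surjection onto one of the summands. -/
def coprodRepPoint {n : ℕ+} (x : (LStr.coprodRep d).dom n) :
    (coprodRepFunctor d).obj (powAlg.{u} n) :=
  ⟨{  toFun := fun s => {y : ULift.{u} (Fin (n : ℕ)) | ⟨x.1, x.2.1 y.down⟩ ∈ s}
      map_bot := rfl
      map_top := rfl
      map_sup := fun _ _ => rfl
      map_inf := fun _ _ => rfl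
      map_dia := fun s => by
        refine Set.ext fun y => ⟨?_, fun ⟨y', h⟩ => ⟨_, h, rfl⟩⟩
        rintro ⟨⟨i, j⟩, hj, rfl : i = x.1⟩
        obtain ⟨y', rfl⟩ := x.2.2 j
        exact ⟨⟨y'⟩, hj⟩ },
    Set.range fun y => ⟨x.1, x.2.1 y⟩, Set.finite_range _, Set.ext fun y =>
      iff_true_intro ⟨y.down, rfl⟩⟩

theorem coprodRepPoint_bijective (n : ℕ+) :
    Function.Bijective (coprodRepPoint d (n := n)) := by
  refine ⟨?_, fun φ => ?_⟩
  · rintro ⟨i, f⟩ ⟨j, g⟩ h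
    have h1 : ∀ y, (⟨i, f.1 y⟩ : Σ i, Fin (d i : ℕ)) = ⟨j, g.1 y⟩ := fun y => by
      -- Testing both homomorphisms on the singleton of a value of `g` shows that the two
      -- surjections agree there.
      have h2 : (show Set (ULift.{u} (Fin (n : ℕ))) from
        (coprodRepPoint d ⟨j, g⟩).1.toFun {⟨j, g.1 y⟩}) ⟨y⟩ := rfl
      rw [← h] at h2
      exact h2
    obtain rfl : i = j := congrArg Sigma.fst (h1 ⟨0, n.pos⟩)
    exact congrArg (Sigma.mk i) (Subtype.ext (funext fun y => eq_of_heq (Sigma.mk.inj (h1 y)).2))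
  · obtain ⟨S, hS, hφ⟩ := φ.2
    obtain ⟨f, hf⟩ := exists_eq_preimage (Y := ULift.{u} (Fin (n : ℕ))) φ.1.toFun φ.1.map_bot
      φ.1.map_sup φ.1.map_inf hS hφ
    have hdia : ∀ s y, f y ∈ S5Algebra.dia s ↔ ∃ y', f y' ∈ s := fun s y =>
      (hf _ y).symm.trans ((iff_of_eq (congrArg (fun t : Set (ULift.{u} (Fin (n : ℕ))) => y ∈ t)
        (φ.1.map_dia s))).trans (exists_congr fun y' => hf s y'))
    -- The set `dia` of a singleton is the summand that contains it, and its preimage under `f` is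
    -- everything once it is nonempty. So `f` stays in one summand; the same argument shows below
    -- that it covers that summand.
    obtain ⟨i, hi⟩ : ∃ i, ∀ y, (f y).1 = i := ⟨_, fun y => by
      obtain ⟨_, rfl, h⟩ := (hdia {f ⟨⟨0, n.pos⟩⟩} y).2 ⟨_, rfl⟩
      exact h.symm⟩
    have hg : ∀ y, ∃ j, f y = ⟨i, j⟩ := fun y => by
      obtain rfl := hi y
      exact ⟨(f y).2, rfl⟩
    choose g hg using hg
    refine ⟨⟨i, fun y => g ⟨y⟩, fun j => ?_⟩, coprodRepFunctor_ext d fun s => Set.ext fun y => ?_⟩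
    · obtain ⟨y, hy⟩ := (hdia {⟨i, j⟩} ⟨⟨0, n.pos⟩⟩).1 ⟨_, rfl, (hi _).symm⟩
      refine ⟨y.down, ?_⟩
      rw [hg y] at hy
      exact eq_of_heq (Sigma.mk.inj hy).2
    · refine Iff.trans ?_ (hf s y).symm
      rw [hg y]
      rfl

/-- The structure of the functor represented by a disjoint union is a coproduct of represented
structures. -/
noncomputable def coprodRepIso : LStr.coprodRep d ≅ evalStr.obj (coprodRepFunctor d) :=
  LStr.isoOfBijective ⟨fun _ x => coprodRepPoint d x, fun _ _ => rfl⟩ (coprodRepPoint_bijective d)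

end Coprod

/-! ### The equivalence of categories -/

theorem mainTheorem3 :
    HasFiniteLimits FinS5Alg.{u} ∧
    ∃ h : ∀ F : FinS5Alg.{u} ⥤ₗ Type u,
        isT₁Model ((LeftExactFunctor.forget FinS5Alg.{u} (Type u) ⋙ evalStr).obj F),
      (isT₁Model.lift
        (LeftExactFunctor.forget FinS5Alg.{u} (Type u) ⋙ evalStr) h).IsEquivalence := by
  have hlex : ∀ F : FinS5Alg.{u} ⥤ₗ Type u, PreservesFiniteLimits F.obj := fun F => F.property
  refine ⟨inferInstance, fun F => ?_, ?_⟩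
  · exact isT₁Model_evalStr F.obj
  · exact
      { faithful := ⟨fun {F G} α β h => by
          refine (LeftExactFunctor.fullyFaithful _ _).map_injective ?_
          have := hlex G
          exact evalStr_map_injective (F := F.obj) (G := G.obj) (congrArg (fun k => isT₁Model.ι.map k) h)⟩
        full := ⟨fun {F G} h => by
          obtain ⟨α, hα⟩ := evalStr_map_surjective (F := F.obj) (G := G.obj) (isT₁Model.ι.map h)
          refine ⟨(LeftExactFunctor.fullyFaithful _ _).preimage α, ?_⟩
          refine isT₁Model.ι.map_injective ?_
          exact hα⟩
        essSurj := ⟨fun M => by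
          obtain ⟨ι, d, ⟨e⟩⟩ := M.property.exists_iso_coprodRep
          exact ⟨⟨coprodRepFunctor d, coprodRepFunctor_preservesFiniteLimits d⟩,
            ⟨isT₁Model.fullyFaithfulι.preimageIso ((coprodRepIso d).symm ≪≫ e)⟩⟩⟩ }
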